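/- Consider the Airy equation $u_t+u_{xxx}=0$ on $(0,1)$, $t>0$, with boundary conditions $u(0,t)=u(1,t)=u_x(1,t)=0$ and initial datum $u(x,0)=u_0(x)$. Let $u_0:[0,1]\to\mathbb C$ be piecewise $C^2$: there is a partition $0=y_0<y_1<\dots<y_n=1$ such that each restriction $u_0|_{(y_j,y_{j+1})}$ extends to a $C^2$ function on $[y_j,y_{j+1}]$ (jumps at the $y_j$ are allowed). Put $\alpha=e^{2\pi i/3}$, $\widehat{u_0}(k)=\int_0^1e^{-ikz}u_0(z)\,dz$ for $k\in\mathbb C$, and $$\Delta(k)=e^{-ik}+\alpha e^{-i\alpha k}+\alpha^2e^{-i\alpha^2k},\qquad \zeta^-(k)=\widehat{u_0}(k)+\alpha\widehat{u_0}(\alpha k)+\alpha^2\widehat{u_0}(\alpha^2k),\qquad \zeta^+(k)=e^{-ik}\zeta^-(k)-\widehat{u_0}(k)\Delta(k).$$ Let $\Gamma^\pm$ be the positively oriented boundary of $\{k\in\mathbb C^\pm:\operatorname{Re}(ik^3)>0\}$, where $\mathbb C^\pm=\{k:\pm\operatorname{Im}k>0\}$. For $x\in(0,1)$ and $t>0$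 define $u$ by the Fokas unified transform representation $$u(x,t)=\frac1{2\pi}\left\{\int_{\mathbb R}e^{ikx+ik^3t}\,\widehat{u_0}(k)\,dk+\int_{\Gamma^+}e^{ikx+ik^3t}\frac{\zeta^+(k)}{\Delta(k)}\,dk+\int_{\Gamma^-}e^{ik(x-1)+ik^3t}\frac{\zeta^-(k)}{\Delta(k)}\,dk\right\},$$ where all integrals are improper integrals along the rays from the origin that make up the contours. Then $\Delta$ has no zeros on $\Gamma^\pm\setminus\{0\}$, all these improper integrals converge for every $x\in(0,1)$ and $t>0$, and $u(\cdot,t)$ is continuous on $(0,1)$ for every $t>0$. -/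

import Mathlib

open Set Filter Topology MeasureTheory

noncomputable section

namespace AiryDirichlet

/-- `f` is piecewise `C²` on `[0,1]`: there is a partition `0 = y₀ < y₁ < ⋯ < yₙ = 1` such that the
restriction of `f` to each open interval `(yⱼ, yⱼ₊₁)` extends to a `C²` function on the closed
interval `[yⱼ, yⱼ₊₁]`. Jumps at the partition points, and any values there, are allowed. -/
def PiecewiseC2 (f : ℝ → ℂ) : Prop :=
  ∃ (n : ℕ) (y : Fin (n + 1) → ℝ), StrictMono y ∧ y 0 = 0 ∧ y (Fin.last n) = 1 ∧
    ∀ j : Fin n, ∃ g : ℝ → ℂ,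
      ContDiffOn ℝ 2 g (Icc (y j.castSucc) (y j.succ)) ∧
      EqOn f g (Ioo (y j.castSucc) (y j.succ))

/-- The primitive cube root of unity `α = exp(2πi/3)`. -/
def alpha : ℂ := Complex.exp (2 * Real.pi * Complex.I / 3)

/-- The Fourier transform on the interval, `û₀(k) = ∫₀¹ exp(-ikz) u₀(z) dz`, for complex `k`. -/
def hat (u₀ : ℝ → ℂ) (k : ℂ) : ℂ :=
  ∫ z in (0 : ℝ)..1, Complex.exp (-Complex.I * k * z) * u₀ z

/-- `Δ(k) = exp(-ik) + α exp(-iαk) + α² exp(-iα²k)`. -/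
def Delta (k : ℂ) : ℂ :=
  Complex.exp (-Complex.I * k) + alpha * Complex.exp (-Complex.I * (alpha * k))
    + alpha ^ 2 * Complex.exp (-Complex.I * (alpha ^ 2 * k))

/-- `ζ⁻(k) = û₀(k) + α û₀(αk) + α² û₀(α²k)`. -/
def zetaMinus (u₀ : ℝ → ℂ) (k : ℂ) : ℂ :=
  hat u₀ k + alpha * hat u₀ (alpha * k) + alpha ^ 2 * hat u₀ (alpha ^ 2 * k)

/-- `ζ⁺(k) = exp(-ik) ζ⁻(k) - û₀(k) Δ(k)`. -/
def zetaPlus (u₀ : ℝ → ℂ) (k : ℂ) : ℂ :=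
  Complex.exp (-Complex.I * k) * zetaMinus u₀ k - hat u₀ k * Delta k

/-- The integrand `F(k) dk` pulled back to the ray `k = r exp(iθ)`, `r ≥ 0`. -/
def rayIntegrand (F : ℂ → ℂ) (θ : ℝ) (r : ℝ) : ℂ :=
  F (r * Complex.exp (θ * Complex.I)) * Complex.exp (θ * Complex.I)

/-- The improper integral of `F` along the ray from `0` to infinity of argument `θ` converges:
`F` is integrable on bounded segments and the truncated integrals have a limit. -/
def RayConverges (F : ℂ → ℂ) (θ : ℝ) : Prop :=
  (∀ R : ℝ, 0 < R → IntervalIntegrable (rayIntegrand F θ) volume 0 R) ∧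
  ∃ I : ℂ, Tendsto (fun R : ℝ => ∫ r in (0 : ℝ)..R, rayIntegrand F θ r) atTop (𝓝 I)

/-- The improper integral of `F` along the outgoing ray of argument `θ`. -/
def rayIntegral (F : ℂ → ℂ) (θ : ℝ) : ℂ :=
  limUnder atTop (fun R : ℝ => ∫ r in (0 : ℝ)..R, rayIntegrand F θ r)

/-- The integral over the positively oriented boundary of the sector `θ₁ < arg k < θ₂`
(interior on the left): out along the ray of argument `θ₁`, back along that of argument `θ₂`. -/
def sectorIntegral (F : ℂ → ℂ) (θ₁ θ₂ : ℝ) : ℂ :=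
  rayIntegral F θ₁ - rayIntegral F θ₂

/-- The improper integral over the real line, from `-∞` to `∞`: in along the ray of argument `π`,
out along the ray of argument `0`. -/
def lineIntegral (F : ℂ → ℂ) : ℂ :=
  rayIntegral F 0 - rayIntegral F Real.pi

/-- The integral over `Γ⁺`, the positively oriented boundary of
`{k : Im k > 0, Re (i k³) > 0} = {π/3 < arg k < 2π/3}`. -/
def gammaPlusIntegral (F : ℂ → ℂ) : ℂ :=
  sectorIntegral F (Real.pi / 3) (2 * Real.pi / 3)

/-- The integral over `Γ⁻`, the positively oriented boundary of
`{k : Im k < 0, Re (i k³) > 0} = {-π < arg k < -2π/3} ∪ {-π/3 < arg k < 0}`. -/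
def gammaMinusIntegral (F : ℂ → ℂ) : ℂ :=
  sectorIntegral F (-Real.pi) (-(2 * Real.pi / 3)) + sectorIntegral F (-(Real.pi / 3)) 0

/-- The integrand `exp(ikx + ik³t) û₀(k)` over the real line. -/
def lineIntegrand (u₀ : ℝ → ℂ) (x t : ℝ) (k : ℂ) : ℂ :=
  Complex.exp (Complex.I * k * x + Complex.I * k ^ 3 * t) * hat u₀ k

/-- The integrand `exp(ikx + ik³t) ζ⁺(k) / Δ(k)` over `Γ⁺`. -/
def plusIntegrand (u₀ : ℝ → ℂ) (x t : ℝ) (k : ℂ) : ℂ :=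
  Complex.exp (Complex.I * k * x + Complex.I * k ^ 3 * t) * (zetaPlus u₀ k / Delta k)

/-- The integrand `exp(ik(x-1) + ik³t) ζ⁻(k) / Δ(k)` over `Γ⁻`. -/
def minusIntegrand (u₀ : ℝ → ℂ) (x t : ℝ) (k : ℂ) : ℂ :=
  Complex.exp (Complex.I * k * (x - 1) + Complex.I * k ^ 3 * t) * (zetaMinus u₀ k / Delta k)

/-- The unified transform representation of the solution of `u_t + u_xxx = 0` on `(0,1)` with
`u(0,t) = u(1,t) = u_x(1,t) = 0` and `u(x,0) = u₀(x)`. -/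
def solution (u₀ : ℝ → ℂ) (x t : ℝ) : ℂ :=
  1 / (2 * Real.pi) *
    (lineIntegral (lineIntegrand u₀ x t)
      + (gammaPlusIntegral (plusIntegrand u₀ x t) + gammaMinusIntegral (minusIntegrand u₀ x t)))

/-- All the improper integrals in the representation converge at `(x,t)`, and the contours avoid the
zeros of `Δ` away from the origin. -/
structure WellDefined (u₀ : ℝ → ℂ) (x t : ℝ) : Prop where
  line : ∀ θ ∈ ({0, Real.pi} : Set ℝ), RayConverges (lineIntegrand u₀ x t) θ
  plus : ∀ θ ∈ ({Real.pi / 3, 2 * Real.pi / 3} : Set ℝ),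
    RayConverges (plusIntegrand u₀ x t) θ
  minus : ∀ θ ∈ ({-Real.pi, -(2 * Real.pi / 3), -(Real.pi / 3), 0} : Set ℝ),
    RayConverges (minusIntegrand u₀ x t) θ
  delta_ne_zero : ∀ θ ∈ ({Real.pi / 3, 2 * Real.pi / 3, -Real.pi, -(2 * Real.pi / 3),
    -(Real.pi / 3), 0} : Set ℝ), ∀ r : ℝ, 0 < r → Delta (r * Complex.exp (θ * Complex.I)) ≠ 0

end AiryDirichlet

end

/-! On every ray `k = ωr` of the contours `ω³` is `1` or `-1`, so `exp(ik³t)` becomes the unimodular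
factor `exp(±itr³)`. The factor `exp(ikx)`, or `exp(ik(x-1))` on `Γ⁻`, has modulus at most `1`, with
no decay on the real rays, where convergence is only claimed in the improper sense. It suffices that
the remaining amplitude be bounded near `0` and bounded with bounded derivative at infinity. One
integration by parts against the cubic phase then leaves an integrand that is `O(r⁻²)` uniformly in
`x`, and dominated convergence gives continuity (`exists_oscillatory_limit`).

The amplitudes are controlled as follows. Near `0`, both `ζ⁻` and `Δ` are of size at most a constant
times `|k|²`, and `Δ` is exactly of that order, so the quotient is bounded. At infinity on the rays
of `Γ⁺`, `exp(-ik)` dominates `Δ`, and multiplying numerator and denominator by `exp(ik)` makes all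
terms bounded and the denominator bounded below. The rays of `Γ⁻` are rotations of those of `Γ⁺` by
`α` or `α²`, and `ζ⁻/Δ` is invariant under these rotations. The datum enters through its
integrability on `(0,1)`. -/

namespace AiryDirichlet

/-! ### Bounded `C¹` amplitudes -/

/-- `f` is differentiable on `(0, ∞)`, and `f` and its derivative are bounded on `[1, ∞)`. -/
def BoundedC1 (f : ℝ → ℂ) : Prop :=
  (∀ r, 0 < r → DifferentiableAt ℝ f r) ∧ ∃ C, ∀ r, 1 ≤ r → ‖f r‖ ≤ C ∧ ‖deriv f r‖ ≤ C

namespace BoundedC1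

variable {f g : ℝ → ℂ}

theorem const (c : ℂ) : BoundedC1 fun _ => c :=
  ⟨fun _ _ => by fun_prop, ‖c‖, fun _ _ => by simp⟩

theorem add (hf : BoundedC1 f) (hg : BoundedC1 g) : BoundedC1 fun r => f r + g r := by
  obtain ⟨df, A, hA⟩ := hf
  obtain ⟨dg, B, hB⟩ := hg
  refine ⟨fun r hr => (df r hr).add (dg r hr), A + B, fun r hr => ?_⟩
  have h0 : 0 < r := by linarith
  rw [deriv_fun_add (df r h0) (dg r h0)]
  exact ⟨norm_add_le_of_le (hA r hr).1 (hB r hr).1, norm_add_le_of_le (hA r hr).2 (hB r hr).2⟩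

theorem mul (hf : BoundedC1 f) (hg : BoundedC1 g) : BoundedC1 fun r => f r * g r := by
  obtain ⟨df, A, hA⟩ := hf
  obtain ⟨dg, B, hB⟩ := hg
  have hA0 : 0 ≤ A := (norm_nonneg _).trans (hA 1 le_rfl).1
  have hB0 : 0 ≤ B := (norm_nonneg _).trans (hB 1 le_rfl).1
  refine ⟨fun r hr => (df r hr).mul (dg r hr), A * B + A * B, fun r hr => ?_⟩
  have h0 : 0 < r := by linarith
  obtain ⟨a1, a2⟩ := hA r hr
  obtain ⟨b1, b2⟩ := hB r hr
  rw [deriv_fun_mul (df r h0) (dg r h0)]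
  constructor
  · exact (norm_mul_le_of_le a1 b1).trans (by nlinarith)
  · exact norm_add_le_of_le (norm_mul_le_of_le a2 b1) (norm_mul_le_of_le a1 b2)

theorem inv (hf : BoundedC1 f) (h0 : ∀ r, 0 < r → f r ≠ 0) {c : ℝ} (hc : 0 < c)
    (hfc : ∀ r, 1 ≤ r → c ≤ ‖f r‖) : BoundedC1 fun r => (f r)⁻¹ := by
  obtain ⟨df, A, hA⟩ := hf
  have hA0 : 0 ≤ A := (norm_nonneg _).trans (hA 1 le_rfl).1
  refine ⟨fun r hr => (df r hr).inv (h0 r hr), c⁻¹ + A / c ^ 2, fun r hr => ?_⟩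
  have hr0 : 0 < r := by linarith
  have hd : deriv (fun r => (f r)⁻¹) r = -deriv f r / f r ^ 2 :=
    ((df r hr0).hasDerivAt.fun_inv (h0 r hr0)).deriv
  have hcr := hfc r hr
  have h1 : ‖(f r)⁻¹‖ ≤ c⁻¹ := by
    rw [norm_inv]; exact inv_anti₀ hc hcr
  have h2 : ‖-deriv f r / f r ^ 2‖ ≤ A / c ^ 2 := by
    rw [norm_div, norm_neg, norm_pow]
    exact div_le_div₀ hA0 (hA r hr).2 (by positivity) (by gcongr)
  rw [hd]
  exact ⟨h1.trans (le_add_of_nonneg_right (by positivity)),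
    h2.trans (le_add_of_nonneg_left (by positivity))⟩

end BoundedC1

/-- The Laplace-type transform of an integrable function along an exponent with nonpositive real
part is bounded with bounded derivative. -/
theorem boundedC1_integral_exp {u : ℝ → ℂ} (hu : IntervalIntegrable u volume 0 1) (a b : ℂ)
    (hab : ∀ z ∈ Icc (0 : ℝ) 1, (a * z + b).re ≤ 0) :
    BoundedC1 fun r => ∫ z in (0 : ℝ)..1, Complex.exp ((a * z + b) * r) * u z := by
  have hexp : ∀ r : ℝ, 0 ≤ r → ∀ z ∈ Icc (0 : ℝ) 1, ‖Complex.exp ((a * z + b) * r)‖ ≤ 1 := by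
    intro r hr z hz
    rw [Complex.norm_exp, Real.exp_le_one_iff, Complex.re_mul_ofReal]
    exact mul_nonpos_of_nonpos_of_nonneg (hab z hz) hr
  have hlin : ∀ z ∈ Icc (0 : ℝ) 1, ‖a * z + b‖ ≤ ‖a‖ + ‖b‖ := by
    intro z hz
    refine norm_add_le_of_le ?_ le_rfl
    rw [norm_mul, Complex.norm_real, Real.norm_of_nonneg hz.1]
    exact mul_le_of_le_one_right (norm_nonneg _) hz.2
  have hI : uIoc (0 : ℝ) 1 ⊆ Icc 0 1 := by
    rw [uIoc_of_le zero_le_one]; exact Ioc_subset_Icc_self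
  have hmeas : ∀ F : ℝ → ℂ, Continuous F →
      AEStronglyMeasurable (fun z => F z * u z) (volume.restrict (uIoc (0 : ℝ) 1)) := fun F hF =>
    hF.aestronglyMeasurable.mul hu.def'.aestronglyMeasurable
  have hder : ∀ r : ℝ, 0 < r → HasDerivAt
      (fun r : ℝ => ∫ z in (0 : ℝ)..1, Complex.exp ((a * z + b) * r) * u z)
      (∫ z in (0 : ℝ)..1, (a * z + b) * Complex.exp ((a * z + b) * r) * u z) r := by
    intro r hr
    refine (intervalIntegral.hasDerivAt_integral_of_dominated_loc_of_deriv_le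
      (F := fun (r : ℝ) (z : ℝ) => Complex.exp ((a * z + b) * r) * u z)
      (F' := fun (r : ℝ) (z : ℝ) => (a * z + b) * Complex.exp ((a * z + b) * r) * u z)
      (bound := fun z => (‖a‖ + ‖b‖) * ‖u z‖) (Ioi_mem_nhds hr)
      (Eventually.of_forall fun s => hmeas (fun z => Complex.exp ((a * z + b) * s)) (by fun_prop))
      ?_
      (hmeas (fun z => (a * z + b) * Complex.exp ((a * z + b) * r)) (by fun_prop))
      ?_ (hu.norm.const_mul _) ?_).2
    · exact hu.continuousOn_mul (by fun_prop)
    · refine Eventually.of_forall fun z hz s hs => ?_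
      rw [norm_mul, norm_mul]
      gcongr
      exact (mul_le_mul (hlin z (hI hz)) (hexp s (le_of_lt hs) z (hI hz)) (norm_nonneg _)
        (by positivity)).trans_eq (mul_one _)
    · refine Eventually.of_forall fun z _ s _ => ?_
      have h1 : HasDerivAt (fun s : ℝ => (a * z + b) * (s : ℂ)) (a * z + b) s := by
        simpa using (Complex.ofRealCLM.hasDerivAt (x := s)).const_mul (a * z + b)
      simpa [mul_comm] using (h1.cexp.mul_const (u z))
  have hbound : ∀ (F : ℝ → ℂ) (K : ℝ), (∀ z ∈ Icc (0 : ℝ) 1, ‖F z‖ ≤ K) →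
      ‖∫ z in (0 : ℝ)..1, F z * u z‖ ≤ ∫ z in (0 : ℝ)..1, K * ‖u z‖ := by
    intro F K hF
    refine intervalIntegral.norm_integral_le_of_norm_le zero_le_one
      (Eventually.of_forall fun z hz => ?_) (hu.norm.const_mul _)
    rw [norm_mul]
    gcongr
    exact hF z (Ioc_subset_Icc_self hz)
  refine ⟨fun r hr => (hder r hr).differentiableAt,
    max (∫ z in (0 : ℝ)..1, 1 * ‖u z‖) (∫ z in (0 : ℝ)..1, (‖a‖ + ‖b‖) * ‖u z‖), fun r hr => ?_⟩
  have h0 : 0 < r := by linarith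
  rw [(hder r h0).deriv]
  refine ⟨(hbound _ _ (hexp r h0.le)).trans (le_max_left _ _),
    (hbound _ _ fun z hz => ?_).trans (le_max_right _ _)⟩
  rw [norm_mul]
  exact (mul_le_mul (hlin z hz) (hexp r h0.le z hz) (norm_nonneg _)
    (by positivity)).trans_eq (mul_one _)

theorem boundedC1_exp (c : ℂ) (hc : c.re ≤ 0) : BoundedC1 fun r => Complex.exp (c * r) := by
  simpa using boundedC1_integral_exp (u := fun _ => 1) (by simp) 0 c
    (fun _ _ => by simpa using hc)

/-! ### Oscillatory integrals with cubic phase -/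

theorem norm_exp_mul_ofReal_le_one {c : ℂ} {y r : ℝ} (hy : (c * y).re ≤ 0) (hr : 0 ≤ r) :
    ‖Complex.exp (c * y * r)‖ ≤ 1 := by
  rw [Complex.norm_exp, Real.exp_le_one_iff, Complex.re_mul_ofReal]
  exact mul_nonpos_of_nonpos_of_nonneg hy hr

theorem norm_exp_I_mul_cube (τ r : ℝ) : ‖Complex.exp (Complex.I * τ * r ^ 3)‖ = 1 := by
  rw [show Complex.I * τ * (r : ℂ) ^ 3 = ((τ * r ^ 3 : ℝ) : ℂ) * Complex.I by push_cast; ring]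
  exact Complex.norm_exp_ofReal_mul_I _

/-- Convergence of the improper integral of a bounded `C¹` amplitude against the cubic phase
`exp(iτr³)`, and its continuous dependence on the parameter `y`. -/
theorem exists_oscillatory_limit {τ : ℝ} (hτ : τ ≠ 0) {c : ℂ} (hc : ‖c‖ ≤ 1) {g : ℝ → ℂ}
    (hg : BoundedC1 g) {B : ℝ} (hB : ∀ r, 0 < r → r ≤ 1 → ‖g r‖ ≤ B) :
    ∃ J : ℝ → ℂ, ContinuousOn J {y | |y| ≤ 1 ∧ (c * y).re ≤ 0} ∧
      ∀ y : ℝ, |y| ≤ 1 → (c * y).re ≤ 0 →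
        (∀ R : ℝ, 0 < R → IntervalIntegrable (fun r : ℝ =>
          Complex.exp (Complex.I * τ * r ^ 3) * (Complex.exp (c * y * r) * g r)) volume 0 R) ∧
        Tendsto (fun R : ℝ => ∫ r in (0 : ℝ)..R,
          Complex.exp (Complex.I * τ * r ^ 3) * (Complex.exp (c * y * r) * g r))
          atTop (𝓝 (J y)) := by
  obtain ⟨dg, C, hC⟩ := hg
  have hC0 : 0 ≤ C := (norm_nonneg _).trans (hC 1 le_rfl).1
  set φ : ℝ → ℝ → ℂ := fun y r =>
    Complex.exp (Complex.I * τ * r ^ 3) * (Complex.exp (c * y * r) * g r) with hφ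
  -- `P` is the boundary term of the integration by parts, since `exp(iτr³)` has derivative `3iτr²
  -- exp(iτr³)`; `q` is the error, with `P' = φ + q`.
  set P : ℝ → ℝ → ℂ := fun y r => φ y r * (3 * Complex.I * τ * r ^ 2)⁻¹ with hP
  set q : ℝ → ℝ → ℂ := fun y r =>
    Complex.exp (Complex.I * τ * r ^ 3) * (Complex.exp (c * y * r) *
      ((c * y * g r + deriv g r) * (3 * Complex.I * τ * r ^ 2)⁻¹
        - 2 * g r * (3 * Complex.I * τ * r ^ 3)⁻¹)) with hq
  have hgm : AEStronglyMeasurable g (volume.restrict (Ioi 0)) :=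
    (ContinuousOn.aestronglyMeasurable
      (fun r hr => (dg r hr).continuousAt.continuousWithinAt) measurableSet_Ioi)
  have hφm : ∀ y, AEStronglyMeasurable (φ y) (volume.restrict (Ioi 0)) := fun y =>
    ((by fun_prop : Continuous fun r : ℝ =>
      Complex.exp (Complex.I * τ * r ^ 3)).aestronglyMeasurable).mul
      (((by fun_prop : Continuous fun r : ℝ =>
      Complex.exp (c * y * r)).aestronglyMeasurable).mul hgm)
  have hgM : ∀ r, 0 < r → ‖g r‖ ≤ max B C := fun r hr => by
    rcases le_total r 1 with h | h
    · exact (hB r hr h).trans (le_max_left _ _)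
    · exact (hC r h).1.trans (le_max_right _ _)
  have hφb : ∀ y : ℝ, (c * y).re ≤ 0 → ∀ r, 0 < r → ‖φ y r‖ ≤ max B C := by
    intro y hy r hr
    rw [hφ]
    simp only [norm_mul, norm_exp_I_mul_cube, one_mul]
    exact (mul_le_mul (norm_exp_mul_ofReal_le_one hy hr.le) (hgM r hr) (norm_nonneg _)
      zero_le_one).trans_eq (one_mul _)
  have hφi : ∀ y : ℝ, (c * y).re ≤ 0 → ∀ R : ℝ, 0 ≤ R → IntervalIntegrable (φ y) volume 0 R := by
    intro y hy R hR
    rw [intervalIntegrable_iff_integrableOn_Ioc_of_le hR]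
    refine (integrable_const (max B C)).mono' ((hφm y).mono_set Ioc_subset_Ioi_self) ?_
    filter_upwards [ae_restrict_mem measurableSet_Ioc] with r hr
    exact hφb y hy r hr.1
  have hqm : ∀ y, AEStronglyMeasurable (q y) (volume.restrict (Ioi 1)) := by
    intro y
    have hg1 : AEStronglyMeasurable g (volume.restrict (Ioi 1)) :=
      hgm.mono_measure (Measure.restrict_mono (Ioi_subset_Ioi zero_le_one) le_rfl)
    have hd : AEStronglyMeasurable (deriv g) (volume.restrict (Ioi 1)) :=
      (stronglyMeasurable_deriv g).aestronglyMeasurable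
    have hm2 : AEStronglyMeasurable (fun r : ℝ => (3 * Complex.I * τ * (r : ℂ) ^ 2)⁻¹)
        (volume.restrict (Ioi 1)) := by
      apply Measurable.aestronglyMeasurable; fun_prop
    have hm3 : AEStronglyMeasurable (fun r : ℝ => (3 * Complex.I * τ * (r : ℂ) ^ 3)⁻¹)
        (volume.restrict (Ioi 1)) := by
      apply Measurable.aestronglyMeasurable; fun_prop
    exact ((by fun_prop : Continuous fun r : ℝ =>
      Complex.exp (Complex.I * τ * r ^ 3)).aestronglyMeasurable).mul
      (((by fun_prop : Continuous fun r : ℝ =>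
      Complex.exp (c * y * r)).aestronglyMeasurable).mul
      ((((hg1.const_mul _).add hd).mul hm2).sub ((hg1.const_mul 2).mul hm3)))
  -- `2C` comes from `c y g + g'` with `|cy| ≤ 1`, and `2C` from `2g`, where `r⁻³ ≤ r⁻²`. The bound
  -- does not depend on `y`.
  set K : ℝ := 4 * C * (3 * |τ|)⁻¹ with hK
  have hqb : ∀ y : ℝ, |y| ≤ 1 → (c * y).re ≤ 0 → ∀ r, 1 < r → ‖q y r‖ ≤ K * r ^ (-2 : ℝ) := by
    intro y hy1 hy r hr
    have hr0 : 0 < r := by linarith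
    obtain ⟨h1, h2⟩ := hC r hr.le
    have hcy : ‖c * y‖ ≤ 1 := by
      rw [norm_mul, Complex.norm_real, Real.norm_eq_abs]
      exact mul_le_one₀ hc (abs_nonneg _) hy1
    have h3 : ‖c * y * g r + deriv g r‖ ≤ C + C :=
      norm_add_le_of_le (by
        rw [norm_mul]
        exact (mul_le_mul hcy h1 (norm_nonneg _) zero_le_one).trans_eq (one_mul _)) h2
    have e2 : ‖(3 * Complex.I * τ * (r : ℂ) ^ 2)⁻¹‖ = (3 * |τ|)⁻¹ * (r ^ 2)⁻¹ := by
      simp [abs_of_pos hr0, mul_comm]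
    have e3 : ‖(3 * Complex.I * τ * (r : ℂ) ^ 3)⁻¹‖ ≤ (3 * |τ|)⁻¹ * (r ^ 2)⁻¹ := by
      have : ‖(3 * Complex.I * τ * (r : ℂ) ^ 3)⁻¹‖ = (3 * |τ|)⁻¹ * (r ^ 3)⁻¹ := by
        simp [abs_of_pos hr0, mul_comm]
      rw [this]
      gcongr
      · exact hr.le
      · norm_num
    have h4 : ‖(c * y * g r + deriv g r) * (3 * Complex.I * τ * (r : ℂ) ^ 2)⁻¹
        - 2 * g r * (3 * Complex.I * τ * (r : ℂ) ^ 3)⁻¹‖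
        ≤ (C + C) * ((3 * |τ|)⁻¹ * (r ^ 2)⁻¹) + 2 * C * ((3 * |τ|)⁻¹ * (r ^ 2)⁻¹) := by
      refine norm_sub_le_of_le (norm_mul_le_of_le h3 e2.le) (norm_mul_le_of_le ?_ e3)
      rw [norm_mul, Complex.norm_two]
      gcongr
    rw [hq]
    simp only [norm_mul, norm_exp_I_mul_cube, one_mul]
    refine (mul_le_mul (norm_exp_mul_ofReal_le_one hy hr0.le) h4 (norm_nonneg _)
      zero_le_one).trans_eq ?_
    rw [Real.rpow_neg hr0.le, hK]
    norm_num
    ring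
  have hKi : IntegrableOn (fun r : ℝ => K * r ^ (-2 : ℝ)) (Ioi 1) :=
    (integrableOn_Ioi_rpow_of_lt (by norm_num) one_pos).const_mul K
  have hqi : ∀ y : ℝ, |y| ≤ 1 → (c * y).re ≤ 0 → IntegrableOn (q y) (Ioi 1) := fun y hy1 hy =>
    hKi.mono' (hqm y) ((ae_restrict_mem measurableSet_Ioi).mono fun r hr => hqb y hy1 hy r hr)
  have hPd : ∀ y r : ℝ, 0 < r → HasDerivAt (P y) (φ y r + q y r) r := by
    intro y r hr
    have hτC : (τ : ℂ) ≠ 0 := by exact_mod_cast hτ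
    have hrC : (r : ℂ) ≠ 0 := by exact_mod_cast hr.ne'
    have hid : HasDerivAt (fun r : ℝ => (r : ℂ)) 1 r := Complex.ofRealCLM.hasDerivAt
    have d1 := ((hid.fun_pow 3).const_mul (Complex.I * τ)).cexp
    have d2 := (hid.const_mul (c * y)).cexp
    have d3 := ((hid.fun_pow 2).const_mul (3 * Complex.I * τ)).fun_inv
      (by simp [hτ, hr.ne'] : 3 * Complex.I * τ * (r : ℂ) ^ 2 ≠ 0)
    have d := (d1.mul (d2.mul (dg r hr).hasDerivAt)).mul d3
    refine d.congr_deriv ?_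
    simp only [hφ, hq, Pi.mul_apply]
    field_simp
    push_cast
    ring
  have hlim : ∀ y : ℝ, |y| ≤ 1 → (c * y).re ≤ 0 →
      Tendsto (fun R : ℝ => ∫ r in (0 : ℝ)..R, φ y r) atTop
        (𝓝 ((∫ r in (0 : ℝ)..1, φ y r) + ((0 - P y 1) - ∫ r in Ioi 1, q y r))) := by
    intro y hy1 hy
    have hP0 : Tendsto (P y) atTop (𝓝 0) := by
      have h1 : Tendsto (fun r : ℝ => max B C * ((3 * |τ|)⁻¹ * (r ^ 2)⁻¹)) atTop (𝓝 0) := by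
        have : Tendsto (fun r : ℝ => (r ^ 2)⁻¹) atTop (𝓝 0) :=
          (tendsto_pow_atTop two_ne_zero).inv_tendsto_atTop
        simpa using (this.const_mul ((3 * |τ|)⁻¹)).const_mul (max B C)
      refine squeeze_zero_norm' ?_ h1
      filter_upwards [eventually_gt_atTop 0] with r hr
      refine norm_mul_le_of_le (hφb y hy r hr) (le_of_eq ?_)
      simp [abs_of_pos hr, mul_comm]
    have hq0 := intervalIntegral_tendsto_integral_Ioi 1 (hqi y hy1 hy) tendsto_id
    refine (((hP0.sub_const (P y 1)).sub hq0).const_add (∫ r in (0 : ℝ)..1, φ y r)).congr' ?_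
    filter_upwards [eventually_ge_atTop 1] with R hR
    have i1 : IntervalIntegrable (φ y) volume 1 R :=
      (hφi y hy 1 zero_le_one).symm.trans (hφi y hy R (by linarith))
    have i2 : IntervalIntegrable (q y) volume 1 R :=
      (intervalIntegrable_iff_integrableOn_Ioc_of_le hR).2
        ((hqi y hy1 hy).mono_set Ioc_subset_Ioi_self)
    have hftc := intervalIntegral.integral_eq_sub_of_hasDerivAt (f := P y)
      (f' := fun r => φ y r + q y r) (a := 1) (b := R)
      (fun r hr => hPd y r (by
        rw [uIcc_of_le hR] at hr; linarith [hr.1])) (i1.add i2)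
    rw [intervalIntegral.integral_add i1 i2] at hftc
    rw [← intervalIntegral.integral_add_adjacent_intervals (hφi y hy 1 zero_le_one) i1, ← hftc]
    simp only [id]
    ring
  refine ⟨_, ?_, fun y hy1 hy => ⟨fun R hR => hφi y hy R hR.le, hlim y hy1 hy⟩⟩
  -- The limit found in `hlim` has three terms: the two integrals are continuous in `y` by
  -- domination, with bounds `max B C` on `(0,1]` and `K r⁻²` beyond.
  refine ContinuousOn.add ?_ ((continuousOn_const.sub ?_).sub ?_)
  · intro y₀ hy₀
    refine intervalIntegral.continuousWithinAt_of_dominated_interval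
      (bound := fun _ => max B C) ?_ ?_ (by simp) ?_
    · refine Eventually.of_forall fun y => (hφm y).mono_measure (Measure.restrict_mono ?_ le_rfl)
      rw [uIoc_of_le zero_le_one]
      exact Ioc_subset_Ioi_self
    · filter_upwards [self_mem_nhdsWithin] with y hy
      refine Eventually.of_forall fun r hr => ?_
      rw [uIoc_of_le zero_le_one] at hr
      exact hφb y hy.2 r hr.1
    · exact Eventually.of_forall fun r _ => by
        apply Continuous.continuousWithinAt; fun_prop
  · apply Continuous.continuousOn; fun_prop
  · intro y₀ hy₀
    refine continuousWithinAt_of_dominated (bound := fun r => K * r ^ (-2 : ℝ))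
      (Eventually.of_forall hqm) ?_ hKi ?_
    · filter_upwards [self_mem_nhdsWithin] with y hy
      exact (ae_restrict_mem measurableSet_Ioi).mono fun r hr => hqb y hy.1 hy.2 r hr
    · exact Eventually.of_forall fun r => by
        apply Continuous.continuousWithinAt; fun_prop

theorem PiecewiseC2.intervalIntegrable {f : ℝ → ℂ} (hf : PiecewiseC2 f) :
    IntervalIntegrable f volume 0 1 := by
  obtain ⟨n, y, hy, h0, h1, hj⟩ := hf
  -- Clamping the index by `min · n` turns the finite partition into a sequence over `ℕ`, as
  -- `trans_iterate` expects.
  have key : IntervalIntegrable f volume (y ⟨min 0 n, by omega⟩) (y ⟨min n n, by omega⟩) := by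
    refine IntervalIntegrable.trans_iterate (a := fun m : ℕ => y ⟨min m n, by omega⟩) ?_
    intro k hk
    obtain ⟨g, hg, hfg⟩ := hj ⟨k, hk⟩
    have e1 : (⟨min k n, by omega⟩ : Fin (n + 1)) = (⟨k, hk⟩ : Fin n).castSucc := by
      ext; simp; omega
    have e2 : (⟨min (k + 1) n, by omega⟩ : Fin (n + 1)) = (⟨k, hk⟩ : Fin n).succ := by
      ext; simp; omega
    simp only [e1, e2]
    have hle : y (⟨k, hk⟩ : Fin n).castSucc ≤ y (⟨k, hk⟩ : Fin n).succ :=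
      hy.monotone (Fin.castSucc_lt_succ).le
    have hgi : IntervalIntegrable g volume (y (⟨k, hk⟩ : Fin n).castSucc)
        (y (⟨k, hk⟩ : Fin n).succ) :=
      ContinuousOn.intervalIntegrable (by rw [uIcc_of_le hle]; exact hg.continuousOn)
    rw [intervalIntegrable_iff_integrableOn_Ioo_of_le hle] at hgi ⊢
    exact hgi.congr_fun hfg.symm measurableSet_Ioo
  have e0 : (⟨min 0 n, by omega⟩ : Fin (n + 1)) = 0 := by ext; simp
  have en : (⟨min n n, by omega⟩ : Fin (n + 1)) = Fin.last n := by ext; simp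
  rwa [e0, en, h0, h1] at key

/-! ### Cube roots of unity and rotation symmetry -/

theorem alpha_eq : alpha = -1 / 2 + (√3 / 2 : ℝ) * Complex.I := by
  rw [alpha, show (2 * (Real.pi : ℂ) * Complex.I / 3) = ((Real.pi - Real.pi / 3 : ℝ) : ℂ) *
    Complex.I by push_cast; ring, Complex.exp_mul_I, ← Complex.ofReal_cos, ← Complex.ofReal_sin,
    Real.cos_pi_sub, Real.sin_pi_sub, Real.cos_pi_div_three, Real.sin_pi_div_three]
  push_cast
  ring

theorem ofReal_sqrt_three_sq : ((√3 : ℝ) : ℂ) ^ 2 = 3 := by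
  rw [← Complex.ofReal_pow, Real.sq_sqrt (by norm_num)]; norm_num

theorem alpha_sq : alpha ^ 2 = -1 - alpha := by
  rw [alpha_eq]
  push_cast
  ring_nf
  simp only [Complex.I_sq, ofReal_sqrt_three_sq]
  ring

theorem alpha_cube : alpha ^ 3 = 1 := by
  linear_combination (alpha - 1) * alpha_sq

theorem alpha_ne_zero : alpha ≠ 0 := Complex.exp_ne_zero _

theorem norm_alpha : ‖alpha‖ = 1 := by
  rw [alpha, show (2 * (Real.pi : ℂ) * Complex.I / 3) = ((2 * Real.pi / 3 : ℝ) : ℂ) *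
    Complex.I by push_cast; ring]
  exact Complex.norm_exp_ofReal_mul_I _

theorem alpha_im : alpha.im = √3 / 2 := by
  rw [alpha_eq]; simp [← Complex.ofReal_ofNat]

/-- The rotation permutes the three terms cyclically. `ζ⁻` picks up the same factor, so `ζ⁻/Δ` is
invariant, which carries estimates from `Γ⁺` over to `Γ⁻`. -/
theorem Delta_alpha_mul (k : ℂ) : Delta (alpha * k) = alpha ^ 2 * Delta k := by
  have e : alpha ^ 2 * (alpha * k) = k := by linear_combination k * alpha_cube
  have e' : alpha * (alpha * k) = alpha ^ 2 * k := by ring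
  rw [Delta, Delta, e, e']
  linear_combination (-Complex.exp (-Complex.I * (alpha * k))
    - alpha * Complex.exp (-Complex.I * (alpha ^ 2 * k))) * alpha_cube

theorem zetaMinus_alpha_mul (u₀ : ℝ → ℂ) (k : ℂ) :
    zetaMinus u₀ (alpha * k) = alpha ^ 2 * zetaMinus u₀ k := by
  have e : alpha ^ 2 * (alpha * k) = k := by linear_combination k * alpha_cube
  have e' : alpha * (alpha * k) = alpha ^ 2 * k := by ring
  rw [zetaMinus, zetaMinus, e, e']
  linear_combination (-hat u₀ (alpha * k) - alpha * hat u₀ (alpha ^ 2 * k)) * alpha_cube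

theorem zetaMinus_div_Delta_alpha_mul (u₀ : ℝ → ℂ) (k : ℂ) :
    zetaMinus u₀ (alpha * k) / Delta (alpha * k) = zetaMinus u₀ k / Delta k := by
  rw [Delta_alpha_mul, zetaMinus_alpha_mul]
  exact mul_div_mul_left _ _ (pow_ne_zero 2 alpha_ne_zero)

/-! ### Behaviour near the origin -/

/-- A combination with coefficients `1, α, α²` has norm at most the sum of norms. -/
theorem norm_alpha_comb_le {a b c : ℂ} {M : ℝ} (ha : ‖a‖ ≤ M) (hb : ‖b‖ ≤ M) (hc : ‖c‖ ≤ M) :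
    ‖a + alpha * b + alpha ^ 2 * c‖ ≤ 3 * M := by
  have h := norm_add₃_le (a := a) (b := alpha * b) (c := alpha ^ 2 * c)
  simp only [norm_mul, norm_pow, norm_alpha, one_pow, one_mul] at h
  linarith

/-- The Taylor terms of orders `0` and `1` cancel because `1 + α + α² = 0` and `1 + α² + α⁴ = 0`. -/
theorem norm_Delta_le {k : ℂ} (hk : ‖k‖ ≤ 1) : ‖Delta k‖ ≤ 3 * ‖k‖ ^ 2 := by
  have e : Delta k = (Complex.exp (-Complex.I * k) - 1 - -Complex.I * k)
      + alpha * (Complex.exp (-Complex.I * (alpha * k)) - 1 - -Complex.I * (alpha * k))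
      + alpha ^ 2 * (Complex.exp (-Complex.I * (alpha ^ 2 * k)) - 1
        - -Complex.I * (alpha ^ 2 * k)) := by
    rw [Delta]
    linear_combination alpha_sq - Complex.I * k * (alpha * alpha_cube + alpha_sq)
  have h : ∀ w : ℂ, ‖w‖ = ‖k‖ →
      ‖Complex.exp (-Complex.I * w) - 1 - -Complex.I * w‖ ≤ ‖k‖ ^ 2 := fun w hw => by
    have hw' : ‖-Complex.I * w‖ = ‖k‖ := by simp [hw]
    rw [← hw']
    exact Complex.norm_exp_sub_one_sub_id_le (hw'.trans_le hk)
  rw [e]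
  exact norm_alpha_comb_le (h _ rfl) (h _ (by simp [norm_alpha])) (h _ (by simp [norm_alpha]))

/-- At order two `1 + α³ + α⁶ = 3`, so the leading term is `-3k²/2`. The three cubic remainders
total at most `3 · 2/9 · |k|²`, leaving `5/6 ≥ 1/2`. -/
theorem le_norm_Delta {k : ℂ} (hk : ‖k‖ ≤ 1) : 1 / 2 * ‖k‖ ^ 2 ≤ ‖Delta k‖ := by
  set ρ : ℂ → ℂ := fun w => Complex.exp (-Complex.I * w) - (1 + -Complex.I * w
    + (-Complex.I * w) ^ 2 / 2) with hρ
  have e : Delta k = (ρ k + alpha * ρ (alpha * k) + alpha ^ 2 * ρ (alpha ^ 2 * k))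
      - 3 / 2 * k ^ 2 := by
    simp only [hρ]
    rw [Delta]
    have h6 : alpha ^ 6 = 1 := by linear_combination (alpha ^ 3 + 1) * alpha_cube
    linear_combination alpha_sq - Complex.I * k * (alpha * alpha_cube + alpha_sq)
      - (k ^ 2 / 2) * (alpha_cube + h6) + (k ^ 2 / 2) * (1 + alpha ^ 3 + alpha ^ 6) * Complex.I_sq
  have h : ∀ w : ℂ, ‖w‖ = ‖k‖ → ‖ρ w‖ ≤ 2 / 9 * ‖k‖ ^ 2 := fun w hw => by
    have hw' : ‖-Complex.I * w‖ = ‖k‖ := by simp [hw]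
    have hb := Complex.exp_bound (hw'.trans_le hk) (n := 3) (by norm_num)
    simp only [Finset.sum_range_succ, Finset.sum_range_zero, hw'] at hb
    norm_num [Nat.factorial] at hb
    have hρw : ρ w = Complex.exp (-(Complex.I * w)) - (1 + -(Complex.I * w)
        + (Complex.I * w) ^ 2 / 2) := by
      simp only [hρ]; ring_nf
    rw [hρw]
    have : ‖k‖ ^ 3 ≤ ‖k‖ ^ 2 := pow_le_pow_of_le_one (norm_nonneg _) hk (by norm_num)
    linarith
  have h3 := norm_alpha_comb_le (h _ rfl) (h (alpha * k) (by simp [norm_alpha]))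
    (h (alpha ^ 2 * k) (by simp [norm_alpha]))
  have h4 : ‖(3 / 2 * k ^ 2 : ℂ)‖ = 3 / 2 * ‖k‖ ^ 2 := by simp
  rw [e, norm_sub_rev]
  have h5 := norm_sub_norm_le (3 / 2 * k ^ 2 : ℂ)
    (ρ k + alpha * ρ (alpha * k) + alpha ^ 2 * ρ (alpha ^ 2 * k))
  rw [h4] at h5
  nlinarith [sq_nonneg ‖k‖]

/-- This form transfers the quadratic vanishing of `Δ` at the origin to `ζ⁻`. -/
theorem zetaMinus_eq_integral {u₀ : ℝ → ℂ} (hu : IntervalIntegrable u₀ volume 0 1) (k : ℂ) :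
    zetaMinus u₀ k = ∫ z in (0 : ℝ)..1, Delta (z * k) * u₀ z := by
  have hi : ∀ w : ℂ, IntervalIntegrable
      (fun z : ℝ => Complex.exp (-Complex.I * w * z) * u₀ z) volume 0 1 := fun w =>
    hu.continuousOn_mul (by fun_prop)
  rw [zetaMinus, hat, hat, hat, ← intervalIntegral.integral_const_mul,
    ← intervalIntegral.integral_const_mul,
    ← intervalIntegral.integral_add (hi _) ((hi _).const_mul _),
    ← intervalIntegral.integral_add ((hi _).add ((hi _).const_mul _)) ((hi _).const_mul _)]
  refine intervalIntegral.integral_congr fun z _ => ?_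
  simp only [Delta]
  ring_nf

theorem norm_zetaMinus_le {u₀ : ℝ → ℂ} (hu : IntervalIntegrable u₀ volume 0 1) {k : ℂ}
    (hk : ‖k‖ ≤ 1) : ‖zetaMinus u₀ k‖ ≤ 3 * ‖k‖ ^ 2 * ∫ z in (0 : ℝ)..1, ‖u₀ z‖ := by
  rw [zetaMinus_eq_integral hu, ← intervalIntegral.integral_const_mul]
  refine intervalIntegral.norm_integral_le_of_norm_le zero_le_one
    (Eventually.of_forall fun z hz => ?_) (hu.norm.const_mul _)
  have hzk : ‖(z : ℂ) * k‖ ≤ ‖k‖ := by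
    rw [norm_mul, Complex.norm_real, Real.norm_of_nonneg hz.1.le]
    exact mul_le_of_le_one_left (norm_nonneg _) hz.2
  rw [norm_mul]
  gcongr
  exact (norm_Delta_le (hzk.trans hk)).trans (by gcongr)

theorem norm_hat_le {u₀ : ℝ → ℂ} (hu : IntervalIntegrable u₀ volume 0 1) {k : ℂ}
    (hk : ‖k‖ ≤ 1) : ‖hat u₀ k‖ ≤ Real.exp 1 * ∫ z in (0 : ℝ)..1, ‖u₀ z‖ := by
  rw [hat, ← intervalIntegral.integral_const_mul]
  refine intervalIntegral.norm_integral_le_of_norm_le zero_le_one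
    (Eventually.of_forall fun z hz => ?_) (hu.norm.const_mul _)
  rw [norm_mul]
  gcongr
  refine (Complex.norm_exp_le_exp_norm _).trans (Real.exp_le_exp.2 ?_)
  rw [norm_mul, Complex.norm_real, Real.norm_of_nonneg hz.1.le, norm_mul, norm_neg, Complex.norm_I,
    one_mul]
  exact mul_le_one₀ hk hz.1.le hz.2

theorem norm_zetaMinus_div_Delta_le {u₀ : ℝ → ℂ} (hu : IntervalIntegrable u₀ volume 0 1) {k : ℂ}
    (hk : ‖k‖ ≤ 1) : ‖zetaMinus u₀ k / Delta k‖ ≤ 6 * ∫ z in (0 : ℝ)..1, ‖u₀ z‖ := by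
  have hI : 0 ≤ ∫ z in (0 : ℝ)..1, ‖u₀ z‖ :=
    intervalIntegral.integral_nonneg zero_le_one fun _ _ => norm_nonneg _
  rw [norm_div]
  refine div_le_of_le_mul₀ (norm_nonneg _) (by positivity) ((norm_zetaMinus_le hu hk).trans ?_)
  nlinarith [mul_le_mul_of_nonneg_left (le_norm_Delta hk) hI]

/-! ### Behaviour along the rays of `Γ⁺` -/

/-- Directions `κ` of the rays of `Γ⁺`: on `k = κr` the term `exp(-ik)` dominates `Δ(k)`. -/
structure Dominant (κ : ℂ) : Prop where
  norm_eq : ‖κ‖ = 1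
  im_eq : κ.im = √3 / 2
  im_alpha : (alpha * κ).im ≤ 0
  im_alpha_sq : (alpha ^ 2 * κ).im ≤ 0

theorem dominant_alpha : Dominant alpha where
  norm_eq := norm_alpha
  im_eq := alpha_im
  im_alpha := by
    rw [← sq, alpha_sq]; simp [alpha_im]; positivity
  im_alpha_sq := by
    rw [← pow_succ, alpha_cube]; simp

theorem dominant_neg_alpha_sq : Dominant (-alpha ^ 2) where
  norm_eq := by simp [norm_alpha]
  im_eq := by rw [alpha_sq]; simp [alpha_im]
  im_alpha := by
    rw [show alpha * -alpha ^ 2 = -alpha ^ 3 by ring, alpha_cube]; simp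
  im_alpha_sq := by
    rw [show alpha ^ 2 * -alpha ^ 2 = -alpha by linear_combination -alpha * alpha_cube]
    simp [alpha_im]; positivity

/-- `Δ(κr)` normalized by the exponential `exp(-iκr)`. -/
theorem exp_mul_Delta (κ : ℂ) (r : ℝ) : Complex.exp (Complex.I * κ * r) * Delta (r * κ) =
    1 + alpha * Complex.exp (Complex.I * (κ - alpha * κ) * r)
      + alpha ^ 2 * Complex.exp (Complex.I * (κ - alpha ^ 2 * κ) * r) := by
  have e0 : Complex.exp (Complex.I * κ * r) * Complex.exp (-Complex.I * (r * κ)) = 1 := by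
    rw [← Complex.exp_add, ← Complex.exp_zero]; ring_nf
  have e1 : Complex.exp (Complex.I * κ * r) * Complex.exp (-Complex.I * (alpha * (r * κ))) =
      Complex.exp (Complex.I * (κ - alpha * κ) * r) := by
    rw [← Complex.exp_add]; ring_nf
  have e2 : Complex.exp (Complex.I * κ * r) * Complex.exp (-Complex.I * (alpha ^ 2 * (r * κ))) =
      Complex.exp (Complex.I * (κ - alpha ^ 2 * κ) * r) := by
    rw [← Complex.exp_add]; ring_nf
  rw [Delta]
  linear_combination e0 + alpha * e1 + alpha ^ 2 * e2

namespace Dominant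

variable {κ : ℂ} (hκ : Dominant κ)
include hκ

theorem im_pos : 0 < κ.im := by rw [hκ.im_eq]; positivity

theorem boundedC1_exp_mul_Delta :
    BoundedC1 fun r => Complex.exp (Complex.I * κ * r) * Delta (r * κ) := by
  simp only [AiryDirichlet.exp_mul_Delta]
  have h0 := hκ.im_pos
  have h1 := hκ.im_alpha
  have h2 := hκ.im_alpha_sq
  refine ((BoundedC1.const 1).add ((BoundedC1.const alpha).mul (boundedC1_exp _ ?_))).add
    ((BoundedC1.const (alpha ^ 2)).mul (boundedC1_exp _ ?_))
  · rw [Complex.I_mul_re, Complex.sub_im]; linarith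
  · rw [Complex.I_mul_re, Complex.sub_im]; linarith

/-- Each of the two subordinate terms has modulus at most `exp(-Im κ)` for `r ≥ 1`. As `Im κ = √3/2
≥ 17/20`, this is at most `99/200`, so together they leave at least `1/100` of the leading `1`. -/
theorem le_norm_exp_mul_Delta {r : ℝ} (hr : 1 ≤ r) :
    1 / 100 ≤ ‖Complex.exp (Complex.I * κ * r) * Delta (r * κ)‖ := by
  have hs : (17 / 20 : ℝ) ≤ κ.im := by
    rw [hκ.im_eq]
    have : (17 / 10 : ℝ) ≤ √3 := Real.le_sqrt_of_sq_le (by norm_num)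
    linarith
  have hexp : Real.exp (-(17 / 20)) ≤ 99 / 200 := by
    rw [Real.exp_neg]
    have := Real.quadratic_le_exp_of_nonneg (x := 17 / 20) (by norm_num)
    rw [inv_le_comm₀ (Real.exp_pos _) (by norm_num)]
    exact le_trans (by norm_num) this
  have key : ∀ w : ℂ, w.im ≤ 0 →
      ‖Complex.exp (Complex.I * (κ - w) * r)‖ ≤ 99 / 200 := by
    intro w hw
    refine le_trans ?_ hexp
    rw [Complex.norm_exp, Real.exp_le_exp, Complex.re_mul_ofReal, Complex.I_mul_re, Complex.sub_im]
    nlinarith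
  rw [AiryDirichlet.exp_mul_Delta, add_assoc]
  have h1 := key _ hκ.im_alpha
  have h2 := key _ hκ.im_alpha_sq
  set a := Complex.exp (Complex.I * (κ - alpha * κ) * r)
  set b := Complex.exp (Complex.I * (κ - alpha ^ 2 * κ) * r)
  have h3 : ‖alpha * a + alpha ^ 2 * b‖ ≤ 99 / 200 + 99 / 200 :=
    norm_add_le_of_le (by simpa [norm_alpha] using h1) (by simpa [norm_alpha] using h2)
  have h4 := norm_sub_le_norm_add (1 : ℂ) (alpha * a + alpha ^ 2 * b)
  rw [norm_one] at h4
  linarith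

theorem norm_ofReal_mul {r : ℝ} (hr : 0 ≤ r) : ‖(r : ℂ) * κ‖ = r := by
  rw [norm_mul, hκ.norm_eq, mul_one, Complex.norm_real, Real.norm_of_nonneg hr]

/-- The quadratic lower bound covers `r ≤ 1` and exponential dominance covers `r ≥ 1`. -/
theorem Delta_ne_zero {r : ℝ} (hr : 0 < r) : Delta (r * κ) ≠ 0 := by
  rcases le_total r 1 with h | h
  · have hk := hκ.norm_ofReal_mul hr.le
    have := le_norm_Delta (k := r * κ) (by rw [hk]; exact h)
    rw [hk] at this
    exact norm_pos_iff.1 (lt_of_lt_of_le (by positivity) this)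
  · have := hκ.le_norm_exp_mul_Delta h
    intro h0
    rw [h0, mul_zero, norm_zero] at this
    norm_num at this

end Dominant

/-- The exponent `-iwz + b` is affine in `z`, so the sign of its real part on `[0,1]` need only be
checked at the endpoints; these are the two hypotheses. -/
theorem boundedC1_exp_mul_hat {u₀ : ℝ → ℂ} (hu : IntervalIntegrable u₀ volume 0 1) (w b : ℂ)
    (hb : b.re ≤ 0) (hwb : w.im + b.re ≤ 0) :
    BoundedC1 fun r => Complex.exp (b * r) * hat u₀ (r * w) := by
  have h := boundedC1_integral_exp hu (-Complex.I * w) b (fun z hz => by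
    rw [Complex.add_re, Complex.re_mul_ofReal, neg_mul, Complex.neg_re, Complex.I_mul_re, neg_neg]
    nlinarith [hz.1, hz.2])
  convert h using 2 with r
  rw [hat, ← intervalIntegral.integral_const_mul]
  refine intervalIntegral.integral_congr fun z _ => ?_
  rw [← mul_assoc, ← Complex.exp_add]
  ring_nf

namespace Dominant

variable {κ : ℂ} (hκ : Dominant κ) {u₀ : ℝ → ℂ} (hu : IntervalIntegrable u₀ volume 0 1)
include hκ hu

theorem boundedC1_zetaMinus_div_Delta :
    BoundedC1 fun r : ℝ => zetaMinus u₀ (r * κ) / Delta (r * κ) := by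
  have h0 := hκ.im_pos
  have hI : (Complex.I * κ).re ≤ 0 := by rw [Complex.I_mul_re]; linarith
  have hN := ((boundedC1_exp_mul_hat hu κ (Complex.I * κ) hI (by simp)).add
    ((BoundedC1.const alpha).mul (boundedC1_exp_mul_hat hu (alpha * κ) (Complex.I * κ) hI
      (add_nonpos hκ.im_alpha hI)))).add
    ((BoundedC1.const (alpha ^ 2)).mul (boundedC1_exp_mul_hat hu (alpha ^ 2 * κ) (Complex.I * κ) hI
      (add_nonpos hκ.im_alpha_sq hI)))
  have hD := hκ.boundedC1_exp_mul_Delta.inv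
    (fun r hr => mul_ne_zero (Complex.exp_ne_zero _) (hκ.Delta_ne_zero hr)) (c := 1 / 100)
    (by norm_num) (fun r hr => hκ.le_norm_exp_mul_Delta hr)
  convert hN.mul hD using 2 with r
  rw [zetaMinus, ← div_eq_mul_inv, ← mul_div_mul_left _ _ (Complex.exp_ne_zero (Complex.I * κ * r))]
  ring_nf

/-- In `ζ⁺` the two products `exp(-ik) û₀(k)` cancel. After multiplication by `exp(ik)`, the terms
left contain `û₀` and exponentials at `αk`, `α²k`, which are bounded, and `exp(ik) û₀(k)`, bounded
as well. -/
theorem boundedC1_zetaPlus_div_Delta :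
    BoundedC1 fun r : ℝ => zetaPlus u₀ (r * κ) / Delta (r * κ) := by
  have h0 := hκ.im_pos
  have hI : (Complex.I * κ).re ≤ 0 := by rw [Complex.I_mul_re]; linarith
  have hexp : ∀ w : ℂ, w.im ≤ 0 → BoundedC1 fun r => Complex.exp (-Complex.I * w * r) :=
    fun w hw => boundedC1_exp _ (by
      rw [neg_mul, Complex.neg_re, Complex.I_mul_re, neg_neg]; exact hw)
  have hhat : ∀ w : ℂ, w.im ≤ 0 → BoundedC1 fun r => hat u₀ (r * w) := fun w hw => by
    simpa using boundedC1_exp_mul_hat hu w 0 (by simp) (by simpa using hw)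
  have hN := (((BoundedC1.const alpha).mul (hhat _ hκ.im_alpha)).add
    ((BoundedC1.const (alpha ^ 2)).mul (hhat _ hκ.im_alpha_sq))).add
    (((BoundedC1.const (-1)).mul (boundedC1_exp_mul_hat hu κ (Complex.I * κ) hI (by simp))).mul
      (((BoundedC1.const alpha).mul (hexp _ hκ.im_alpha)).add
        ((BoundedC1.const (alpha ^ 2)).mul (hexp _ hκ.im_alpha_sq))))
  have hD := hκ.boundedC1_exp_mul_Delta.inv
    (fun r hr => mul_ne_zero (Complex.exp_ne_zero _) (hκ.Delta_ne_zero hr)) (c := 1 / 100)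
    (by norm_num) (fun r hr => hκ.le_norm_exp_mul_Delta hr)
  convert hN.mul hD using 2 with r
  rw [← div_eq_mul_inv, ← mul_div_mul_left _ _ (Complex.exp_ne_zero (Complex.I * κ * r))]
  congr 1
  have e0 : Complex.exp (Complex.I * κ * r) * Complex.exp (-Complex.I * (r * κ)) = 1 := by
    rw [← Complex.exp_add, ← Complex.exp_zero]; ring_nf
  rw [zetaPlus, zetaMinus, Delta]
  simp only [show -Complex.I * (alpha * κ) * r = -Complex.I * (alpha * (r * κ)) by ring,
    show -Complex.I * (alpha ^ 2 * κ) * r = -Complex.I * (alpha ^ 2 * (r * κ)) by ring,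
    show (r : ℂ) * (alpha * κ) = alpha * (r * κ) by ring,
    show (r : ℂ) * (alpha ^ 2 * κ) = alpha ^ 2 * (r * κ) by ring]
  linear_combination (alpha * hat u₀ (alpha * (r * κ)) + alpha ^ 2 * hat u₀ (alpha ^ 2 * (r * κ)))
    * e0

theorem norm_zetaPlus_div_Delta_le {r : ℝ} (h0 : 0 < r) (h1 : r ≤ 1) :
    ‖zetaPlus u₀ (r * κ) / Delta (r * κ)‖ ≤
      Real.exp 1 * (6 * ∫ z in (0 : ℝ)..1, ‖u₀ z‖) + Real.exp 1 * ∫ z in (0 : ℝ)..1, ‖u₀ z‖ := by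
  have hk : ‖(r : ℂ) * κ‖ ≤ 1 := (hκ.norm_ofReal_mul h0.le).trans_le h1
  have e : zetaPlus u₀ (r * κ) / Delta (r * κ) = Complex.exp (-Complex.I * (r * κ)) *
      (zetaMinus u₀ (r * κ) / Delta (r * κ)) - hat u₀ (r * κ) := by
    have := hκ.Delta_ne_zero h0
    rw [zetaPlus]
    field_simp
  rw [e]
  refine norm_sub_le_of_le (norm_mul_le_of_le ?_ (norm_zetaMinus_div_Delta_le hu hk))
    (norm_hat_le hu hk)
  refine (Complex.norm_exp_le_exp_norm _).trans (Real.exp_le_exp.2 ?_)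
  simpa using hk

end Dominant

/-! ### Convergence and continuity ray by ray -/

/-- Along the ray of argument `θ` the improper integral of `F x` converges for all `x ∈ (0, 1)` and
depends continuously on `x`. -/
def RayRegular (F : ℝ → ℂ → ℂ) (θ : ℝ) : Prop :=
  (∀ x ∈ Ioo (0 : ℝ) 1, RayConverges (F x) θ) ∧
    ContinuousOn (fun x => rayIntegral (F x) θ) (Ioo 0 1)

/-- The shift `s` is `0` on the line and on `Γ⁺`, and `1` on `Γ⁻`. Reality of `ω³` makes the cubic
phase purely oscillatory, and the sign condition in `hs` keeps the linear exponential bounded. -/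
theorem rayRegular_of_oscillatory {F : ℝ → ℂ → ℂ} {G : ℂ → ℂ} {θ s t σ B : ℝ} {ω : ℂ}
    (hω : Complex.exp (θ * Complex.I) = ω) (hσ : ω ^ 3 = σ) (ht : t ≠ 0)
    (hs : ∀ x ∈ Ioo (0 : ℝ) 1, |x - s| ≤ 1 ∧ 0 ≤ ω.im * (x - s))
    (hF : ∀ x k, F x k = Complex.exp (Complex.I * k * (x - s) + Complex.I * k ^ 3 * t) * G k)
    (hG : BoundedC1 fun r => G (r * ω)) (hB : ∀ r : ℝ, 0 < r → r ≤ 1 → ‖G (r * ω)‖ ≤ B) :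
    RayRegular F θ := by
  have hn : ‖ω‖ = 1 := by rw [← hω]; exact Complex.norm_exp_ofReal_mul_I _
  have hσ0 : σ ≠ 0 := by
    rintro rfl
    have h0 : ω = 0 := by simpa using hσ
    simp [h0] at hn
  obtain ⟨J, hJ, hlim⟩ := exists_oscillatory_limit (τ := σ * t) (mul_ne_zero hσ0 ht)
    (c := Complex.I * ω) (by simp [hn]) (hG.mul (BoundedC1.const ω)) (B := B * 1)
    (fun r h0 h1 => norm_mul_le_of_le (hB r h0 h1) hn.le)
  have hS : ∀ x ∈ Ioo (0 : ℝ) 1, |x - s| ≤ 1 ∧ (Complex.I * ω * ((x - s : ℝ) : ℂ)).re ≤ 0 := by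
    intro x hx
    refine ⟨(hs x hx).1, ?_⟩
    rw [Complex.re_mul_ofReal, Complex.I_mul_re]
    linarith [(hs x hx).2]
  have e : ∀ x, rayIntegrand (F x) θ = fun r : ℝ =>
      Complex.exp (Complex.I * ((σ * t : ℝ) : ℂ) * r ^ 3) *
        (Complex.exp (Complex.I * ω * ((x - s : ℝ) : ℂ) * r) * (G (r * ω) * ω)) := by
    intro x
    funext r
    rw [rayIntegrand, hω, hF, ← mul_assoc (Complex.exp _) (Complex.exp _), ← Complex.exp_add,
      mul_assoc]
    push_cast
    rw [← hσ]
    ring_nf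
  have hconv : ∀ x ∈ Ioo (0 : ℝ) 1,
      (∀ R : ℝ, 0 < R → IntervalIntegrable (rayIntegrand (F x) θ) volume 0 R) ∧
      Tendsto (fun R : ℝ => ∫ r in (0 : ℝ)..R, rayIntegrand (F x) θ r) atTop (𝓝 (J (x - s))) := by
    intro x hx
    rw [e]
    exact hlim (x - s) (hS x hx).1 (hS x hx).2
  refine ⟨fun x hx => ⟨(hconv x hx).1, _, (hconv x hx).2⟩, ?_⟩
  have hJs : ContinuousOn (fun x : ℝ => J (x - s)) (Ioo 0 1) :=
    hJ.comp (by fun_prop) fun x hx => hS x hx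
  exact hJs.congr fun x hx => (hconv x hx).2.limUnder_eq

theorem rayRegular_line {u₀ : ℝ → ℂ} (hu : IntervalIntegrable u₀ volume 0 1) {t θ σ : ℝ}
    (ht : t ≠ 0) (hθ : Complex.exp (θ * Complex.I) = σ) (hσ : |σ| = 1) :
    RayRegular (fun x => lineIntegrand u₀ x t) θ := by
  refine rayRegular_of_oscillatory (G := hat u₀) (s := 0) (σ := σ ^ 3) hθ (by push_cast; rfl) ht
    (fun x hx => ⟨?_, by simp⟩) (fun x k => by simp [lineIntegrand]) ?_
    (fun r h0 h1 => norm_hat_le hu (by simpa [hσ, abs_of_pos h0] using h1))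
  · rw [sub_zero, abs_of_pos hx.1]; exact hx.2.le
  · simpa using boundedC1_exp_mul_hat hu σ 0 (by simp) (by simp)

theorem rayRegular_plus {u₀ : ℝ → ℂ} (hu : IntervalIntegrable u₀ volume 0 1) {t θ σ : ℝ} {κ : ℂ}
    (ht : t ≠ 0) (hθ : Complex.exp (θ * Complex.I) = κ) (hκ : Dominant κ) (hσ : κ ^ 3 = σ) :
    RayRegular (fun x => plusIntegrand u₀ x t) θ := by
  refine rayRegular_of_oscillatory (G := fun k => zetaPlus u₀ k / Delta k) (s := 0) hθ hσ ht
    (fun x hx => ⟨?_, mul_nonneg hκ.im_pos.le ?_⟩) (fun x k => by simp [plusIntegrand])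
    (hκ.boundedC1_zetaPlus_div_Delta hu)
    (fun r h0 h1 => hκ.norm_zetaPlus_div_Delta_le hu h0 h1)
  · rw [sub_zero, abs_of_pos hx.1]; exact hx.2.le
  · linarith [hx.1]

/-- By rotation invariance the amplitude at `rω` equals the one at `rκ`; only the linear exponential
sees `ω`, and there `Im ω ≤ 0` matches `x - 1 < 0`. -/
theorem rayRegular_minus {u₀ : ℝ → ℂ} (hu : IntervalIntegrable u₀ volume 0 1) {t θ σ : ℝ}
    {κ ω : ℂ} (ht : t ≠ 0) (hκ : Dominant κ) (hσ : κ ^ 3 = σ)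
    (hω : ω = alpha * κ ∨ ω = alpha ^ 2 * κ) (hθ : Complex.exp (θ * Complex.I) = ω) :
    RayRegular (fun x => minusIntegrand u₀ x t) θ := by
  have hH : ∀ r : ℝ, zetaMinus u₀ (r * ω) / Delta (r * ω) =
      zetaMinus u₀ (r * κ) / Delta (r * κ) := by
    intro r
    rcases hω with rfl | rfl
    · rw [mul_left_comm, zetaMinus_div_Delta_alpha_mul]
    · rw [mul_left_comm, sq, mul_assoc, zetaMinus_div_Delta_alpha_mul,
        zetaMinus_div_Delta_alpha_mul]
  have him : ω.im ≤ 0 := by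
    rcases hω with rfl | rfl
    exacts [hκ.im_alpha, hκ.im_alpha_sq]
  have hσ' : ω ^ 3 = σ := by
    rw [← hσ]
    rcases hω with rfl | rfl
    · rw [mul_pow, alpha_cube, one_mul]
    · rw [mul_pow, ← pow_mul, mul_comm 2 3, pow_mul, alpha_cube, one_pow, one_mul]
  refine rayRegular_of_oscillatory (G := fun k => zetaMinus u₀ k / Delta k) (s := 1) hθ hσ' ht
    (fun x hx => ⟨?_, mul_nonneg_of_nonpos_of_nonpos him ?_⟩) (fun x k => by simp [minusIntegrand])
    (by simpa only [hH] using hκ.boundedC1_zetaMinus_div_Delta hu)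
    (fun r h0 h1 => (hH r).symm ▸
      norm_zetaMinus_div_Delta_le hu ((hκ.norm_ofReal_mul h0.le).trans_le h1))
  · rw [abs_le]; constructor <;> linarith [hx.1, hx.2]
  · linarith [hx.2]

theorem Dominant.Delta_ne_zero_of_eq {κ ω : ℂ} (hκ : Dominant κ)
    (hω : ω = alpha * κ ∨ ω = alpha ^ 2 * κ) {r : ℝ} (hr : 0 < r) : Delta (r * ω) ≠ 0 := by
  have h := hκ.Delta_ne_zero hr
  have ha := pow_ne_zero 2 alpha_ne_zero
  rcases hω with rfl | rfl
  · rw [mul_left_comm, Delta_alpha_mul]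
    exact mul_ne_zero ha h
  · rw [mul_left_comm, sq, mul_assoc, Delta_alpha_mul, Delta_alpha_mul]
    exact mul_ne_zero ha (mul_ne_zero ha h)

/-! ### The six directions as rotations of `α` and `-α²` -/

theorem exp_two_pi_div_three :
    Complex.exp ((2 * Real.pi / 3 : ℝ) * Complex.I) = alpha := by
  rw [alpha]; push_cast; ring_nf

theorem exp_neg_two_pi_div_three :
    Complex.exp ((-(2 * Real.pi / 3) : ℝ) * Complex.I) = alpha * alpha := by
  rw [Complex.ofReal_neg, neg_mul, Complex.exp_neg, exp_two_pi_div_three]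
  exact inv_eq_of_mul_eq_one_right (by linear_combination alpha_cube)

theorem exp_pi_div_three : Complex.exp ((Real.pi / 3 : ℝ) * Complex.I) = -alpha ^ 2 := by
  rw [show ((Real.pi / 3 : ℝ) : ℂ) * Complex.I =
    Real.pi * Complex.I + (-(2 * Real.pi / 3) : ℝ) * Complex.I by push_cast; ring,
    Complex.exp_add, Complex.exp_pi_mul_I, exp_neg_two_pi_div_three]
  ring

theorem exp_neg_pi_div_three :
    Complex.exp ((-(Real.pi / 3) : ℝ) * Complex.I) = alpha ^ 2 * -alpha ^ 2 := by
  rw [show ((-(Real.pi / 3) : ℝ) : ℂ) * Complex.I =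
    -(Real.pi * Complex.I) + (2 * Real.pi / 3 : ℝ) * Complex.I by push_cast; ring,
    Complex.exp_add, Complex.exp_neg, Complex.exp_pi_mul_I, exp_two_pi_div_three]
  linear_combination alpha * alpha_cube

theorem exp_neg_pi : Complex.exp ((-Real.pi : ℝ) * Complex.I) = alpha * -alpha ^ 2 := by
  rw [Complex.ofReal_neg, neg_mul, Complex.exp_neg, Complex.exp_pi_mul_I]
  linear_combination alpha_cube

theorem exp_zero_mul_I : Complex.exp ((0 : ℝ) * Complex.I) = alpha ^ 2 * alpha := by
  rw [Complex.ofReal_zero, zero_mul, Complex.exp_zero]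
  linear_combination -alpha_cube

end AiryDirichlet

open AiryDirichlet in
theorem theorem2 (u₀ : ℝ → ℂ) (hu₀ : AiryDirichlet.PiecewiseC2 u₀) (t : ℝ) (ht : 0 < t) :
    (∀ x ∈ Set.Ioo (0 : ℝ) 1, AiryDirichlet.WellDefined u₀ x t) ∧
    ContinuousOn (fun x : ℝ => AiryDirichlet.solution u₀ x t) (Set.Ioo (0 : ℝ) 1) := by
  have hu := hu₀.intervalIntegrable
  have hκ₁ := dominant_alpha
  have hκ₂ := dominant_neg_alpha_sq
  have c₁ : alpha ^ 3 = ((1 : ℝ) : ℂ) := by rw [alpha_cube]; simp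
  have c₂ : (-alpha ^ 2) ^ 3 = ((-1 : ℝ) : ℂ) := by
    push_cast
    linear_combination (-alpha ^ 3 - 1) * alpha_cube
  have l₀ := rayRegular_line hu ht.ne' (θ := 0) (σ := 1) (by simp) (by simp)
  have l₁ := rayRegular_line hu ht.ne' (θ := Real.pi) (σ := -1) (by simp) (by simp)
  have p₁ := rayRegular_plus hu ht.ne' exp_pi_div_three hκ₂ c₂
  have p₂ := rayRegular_plus hu ht.ne' exp_two_pi_div_three hκ₁ c₁
  have m₁ := rayRegular_minus hu ht.ne' hκ₂ c₂ (Or.inl rfl) exp_neg_pi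
  have m₂ := rayRegular_minus hu ht.ne' hκ₁ c₁ (Or.inl rfl) exp_neg_two_pi_div_three
  have m₃ := rayRegular_minus hu ht.ne' hκ₂ c₂ (Or.inr rfl) exp_neg_pi_div_three
  have m₄ := rayRegular_minus hu ht.ne' hκ₁ c₁ (Or.inr rfl) exp_zero_mul_I
  refine ⟨fun x hx => ⟨?_, ?_, ?_, ?_⟩, ?_⟩
  · rintro θ (rfl | rfl)
    exacts [l₀.1 x hx, l₁.1 x hx]
  · rintro θ (rfl | rfl)
    exacts [p₁.1 x hx, p₂.1 x hx]
  · rintro θ (rfl | rfl | rfl | rfl)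
    exacts [m₁.1 x hx, m₂.1 x hx, m₃.1 x hx, m₄.1 x hx]
  · rintro θ (rfl | rfl | rfl | rfl | rfl | rfl) r hr
    · rw [exp_pi_div_three]; exact hκ₂.Delta_ne_zero hr
    · rw [exp_two_pi_div_three]; exact hκ₁.Delta_ne_zero hr
    · rw [exp_neg_pi]; exact hκ₂.Delta_ne_zero_of_eq (Or.inl rfl) hr
    · rw [exp_neg_two_pi_div_three]; exact hκ₁.Delta_ne_zero_of_eq (Or.inl rfl) hr
    · rw [exp_neg_pi_div_three]; exact hκ₂.Delta_ne_zero_of_eq (Or.inr rfl) hr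
    · rw [exp_zero_mul_I]; exact hκ₁.Delta_ne_zero_of_eq (Or.inr rfl) hr
  · exact continuousOn_const.mul ((l₀.2.sub l₁.2).add
      ((p₁.2.sub p₂.2).add ((m₁.2.sub m₂.2).add (m₃.2.sub m₄.2))))
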